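/- Let $R$ be a commutative ring with identity and let $C$ be a semidualizing $R$-module: $C$ has a projective resolution by finitely generated projective modules, the homothety map $R\to \mathrm{Hom}_R(C,C)$ is an isomorphism, and $\mathrm{Ext}^i_R(C,C)=0$ for all $i\ge 1$. Consider the following classes of $R$-modules. - $\mathcal G(\mathcal F)$, the Gorenstein flat modules: those $M$ for which there is an exact sequence $\mathbb X=\cdots\to F_1\to F_0\to F^0\to F^1\to\cdots$ of flat $R$-modules such that $M\cong\mathrm{im}(F_0\to F^0)$ and $I\otimes_R\mathbb X$ is exact for every injective $R$-module $I$. - $\mathcal A_C(R)$, the Auslander class: those $M$ such that $\mathrm{Tor}^R_i(C,M)=0=\mathrm{Ext}_R^i(C,C\otimes_R M)$ for all $i\ge1$ and the natural map $M\to\mathrm{Hom}_R(C,C\otimes_R M)$, $m\mapsto(c\mapsto c\otimes m)$, is an isomorphism. - $\mathcal G(\mathcal W_F)$, the $\mathcal W_F$-Gorenstein modules: those $M$ for which there is an exact sequence $\mathbb W=\cdots\to W_1\to W_0\to W^0\to W^1\to\cdots$ such that each $W_i$ and each $W^i$ is isomorphic to $C\otimes_R F$ for some flat $R$-module $F$ (depending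 on the term), $M\cong\mathrm{im}(W_0\to W^0)$, the sequence $\mathrm{Hom}_R(C\otimes_R P,\mathbb W)$ is exact for every projective $R$-module $P$, and the sequence $\mathrm{Hom}_R(C,I)\otimes_R\mathbb W$ is exact for every injective $R$-module $I$. Regard $\mathcal G(\mathcal F)\cap\mathcal A_C(R)$ and $\mathcal G(\mathcal W_F)$ as full subcategories of the category of $R$-modules. Then $C\otimes_R-$ maps $\mathcal G(\mathcal F)\cap\mathcal A_C(R)$ into $\mathcal G(\mathcal W_F)$, $\mathrm{Hom}_R(C,-)$ maps $\mathcal G(\mathcal W_F)$ into $\mathcal G(\mathcal F)\cap\mathcal A_C(R)$, and these restricted functors are mutually quasi-inverse equivalences of categories $$C\otimes_R-\;:\;\mathcal G(\mathcal F)\cap\mathcal A_C(R)\;\rightleftarrows\;\mathcal G(\mathcal W_F)\;:\;\mathrm{Hom}_R(C,-).$$ -/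

import Mathlib

open CategoryTheory
open scoped TensorProduct

universe u

namespace Foxby

variable {R : Type u} [CommRing R]

/-- The functor `X ⊗_R -` on `R`-modules. -/
noncomputable abbrev tensorFunctor (X : ModuleCat.{u} R) : ModuleCat.{u} R ⥤ ModuleCat.{u} R :=
  MonoidalCategory.tensorLeft X

/-- The functor `Hom_R(X, -)` from `R`-modules to `R`-modules. -/
abbrev homFunctor (X : ModuleCat.{u} R) : ModuleCat.{u} R ⥤ ModuleCat.{u} R :=
  (linearCoyoneda R (ModuleCat.{u} R)).obj (Opposite.op X)

/-- `Ext_R^i(M, N) = 0` for all `i ≥ 1`. -/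
def ExtVanish (M N : ModuleCat.{u} R) : Prop :=
  ∀ i : ℕ, 1 ≤ i → Subsingleton (Abelian.Ext.{u} M N i)

/-- `Tor^R_i(M, N) = 0` for all `i ≥ 1`. -/
def TorVanish (M N : ModuleCat.{u} R) : Prop :=
  ∀ i : ℕ, 1 ≤ i → Limits.IsZero (((Tor (ModuleCat.{u} R) i).obj M).obj N)

/-- Semidualizing modules over a commutative ring. -/
structure IsSemidualizing (C : ModuleCat.{u} R) : Prop where
  /-- there is a projective resolution by finitely generated projective modules -/
  resolution : ∃ P : ProjectiveResolution C, ∀ n : ℕ, Module.Finite R (P.complex.X n)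
  /-- the homothety map `R → Hom_R(C, C)` is an isomorphism -/
  homothety : Function.Bijective (LinearMap.lsmul R C : R →ₗ[R] C →ₗ[R] C)
  ext_vanish : ExtVanish C C

/-- The Auslander class `A_C(R)`. The last condition is that the natural evaluation map
`M → Hom_R(C, C ⊗_R M)`, `m ↦ (c ↦ c ⊗ m)`, is an isomorphism. -/
def auslanderClass (C : ModuleCat.{u} R) : ObjectProperty (ModuleCat.{u} R) := fun M =>
  TorVanish C M ∧ ExtVanish C ((tensorFunctor C).obj M) ∧
    Function.Bijective ((TensorProduct.mk R C M).flip : M →ₗ[R] C →ₗ[R] C ⊗[R] M)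

/-- `C`-projective modules: `C ⊗_R P` with `P` projective. -/
def cProjective (C : ModuleCat.{u} R) : ObjectProperty (ModuleCat.{u} R) := fun X =>
  ∃ P : ModuleCat.{u} R, Module.Projective R P ∧ Nonempty (X ≃ₗ[R] C ⊗[R] P)

/-- `C`-flat modules: `C ⊗_R F` with `F` flat. -/
def cFlat (C : ModuleCat.{u} R) : ObjectProperty (ModuleCat.{u} R) := fun X =>
  ∃ F : ModuleCat.{u} R, Module.Flat R F ∧ Nonempty (X ≃ₗ[R] C ⊗[R] F)

/-- `C`-injective modules: `Hom_R(C, I)` with `I` injective. -/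
def cInjective (C : ModuleCat.{u} R) : ObjectProperty (ModuleCat.{u} R) := fun X =>
  ∃ I : ModuleCat.{u} R, Module.Injective R I ∧ Nonempty (X ≃ₗ[R] (C →ₗ[R] I))

/-- The complex `K` stays exact after applying the additive functor `F`. -/
def ExactAfter (F : ModuleCat.{u} R ⥤ ModuleCat.{u} R) [F.Additive]
    (K : CochainComplex (ModuleCat.{u} R) ℤ) : Prop :=
  ((F.mapHomologicalComplex (ComplexShape.up ℤ)).obj K).Acyclic

/-- Gorenstein flat modules. The doubly infinite sequence
`⋯ → F₁ → F₀ → F⁰ → F¹ → ⋯` is indexed by `ℤ` with `Fⁿ` in degree `n` and `Fₙ` in degree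
`-n - 1`, so that `F₀ → F⁰` is the differential from degree `-1` to degree `0`. -/
def gorensteinFlat (R : Type u) [CommRing R] : ObjectProperty (ModuleCat.{u} R) := fun M =>
  ∃ K : CochainComplex (ModuleCat.{u} R) ℤ,
    K.Acyclic ∧ (∀ n : ℤ, Module.Flat R (K.X n)) ∧
    Nonempty (M ≃ₗ[R] LinearMap.range (K.d (-1) 0).hom) ∧
    ∀ I : ModuleCat.{u} R, Module.Injective R I → ExactAfter (tensorFunctor I) K

/-- `W_F`-Gorenstein modules (with respect to `C`), with the same indexing as for
`gorensteinFlat`. -/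
def wfGorenstein (C : ModuleCat.{u} R) : ObjectProperty (ModuleCat.{u} R) := fun M =>
  ∃ K : CochainComplex (ModuleCat.{u} R) ℤ,
    K.Acyclic ∧ (∀ n : ℤ, cFlat C (K.X n)) ∧
    Nonempty (M ≃ₗ[R] LinearMap.range (K.d (-1) 0).hom) ∧
    (∀ X : ModuleCat.{u} R, cProjective C X → ExactAfter (homFunctor X) K) ∧
    ∀ J : ModuleCat.{u} R, cInjective C J → ExactAfter (tensorFunctor J) K

end Foxby

/-!
Let `η` and `ε` be the unit and the counit of the adjunction `C ⊗ - ⊣ Hom(C, -)`. Flat modules have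
invertible `η`, `C`-flat modules have invertible `ε`, and the problem is to pass from the terms of
an acyclic complex to its cycles, along the short exact sequences `0 → Zⁿ → Kⁿ → Zⁿ⁺¹ → 0`.

For `Z⁰` in the Auslander class and `K` flat, tensoring with `C` preserves these sequences: in
negative degrees since `Tor(C, Zⁿ)` vanishes for `n ≤ 0`, by induction from `Z⁰` to the left, and in
nonnegative degrees since `η` is invertible on `Zⁿ`, by induction to the right. The inductive step
needs no information on `Tor`: `Hom(C, C ⊗ f)` is isomorphic to `f` for the inclusion
`f : Zⁿ → Kⁿ`, and `Hom(C, -)` reflects monomorphisms because `Hom(C, L) = 0` forces `L = 0`.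
Conversely, if `Hom(C, -)` preserves the exactness of a complex of `C`-flat modules, then `ε` is
invertible on all its cycles, and dimension shifting along the whole complex shows that
`Tor(C, Hom(C, Zⁿ))` and `Ext(C, Zⁿ)` vanish.
-/

namespace Foxby

/-! ### Categories and adjunctions -/

section Adjunction

variable {D E : Type*} [Category D] [Category E] {F : D ⥤ E} {G : E ⥤ D} (adj : F ⊣ G)

theorem isIso_counit_app_obj_of_isIso_unit {X : D} (h : IsIso (adj.unit.app X)) :
    IsIso (adj.counit.app (F.obj X)) := by
  rw [← adj.inv_map_unit]
  infer_instance

theorem isIso_unit_app_obj_of_isIso_counit {Y : E} (h : IsIso (adj.counit.app Y)) :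
    IsIso (adj.unit.app (G.obj Y)) := by
  rw [← adj.inv_counit_map]
  infer_instance

theorem exists_equivalence_fullSubcategory {P : ObjectProperty D} {Q : ObjectProperty E}
    (hF : ∀ X : P.FullSubcategory, Q (F.obj X.obj)) (hG : ∀ Y : Q.FullSubcategory, P (G.obj Y.obj))
    (hunit : ∀ X, P X → IsIso (adj.unit.app X)) (hcounit : ∀ Y, Q Y → IsIso (adj.counit.app Y)) :
    ∃ e : P.FullSubcategory ≌ Q.FullSubcategory, e.functor = Q.lift (P.ι ⋙ F) hF ∧
      e.inverse = P.lift (Q.ι ⋙ G) hG := by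
  let adj' : Q.lift (P.ι ⋙ F) hF ⊣ P.lift (Q.ι ⋙ G) hG :=
    adj.restrictFullyFaithful P.fullyFaithfulι Q.fullyFaithfulι (Iso.refl _) (Iso.refl _)
  have hu (X) : IsIso (adj'.unit.app X) := by
    have := hunit _ X.property
    rw [← isIso_iff_of_reflects_iso _ P.ι, Adjunction.map_restrictFullyFaithful_unit_app]
    simpa using this
  have hc (Y) : IsIso (adj'.counit.app Y) := by
    have := hcounit _ Y.property
    rw [← isIso_iff_of_reflects_iso _ Q.ι, Adjunction.map_restrictFullyFaithful_counit_app]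
    simpa using this
  exact ⟨adj'.toEquivalence, rfl, rfl⟩

end Adjunction

section NaturalTransformation

theorem isIso_τ₃_of_epi_of_isIso {A : Type*} [Category A] [Abelian A] {S₁ S₂ : ShortComplex A}
    (φ : S₁ ⟶ S₂) (hS₁ : Epi S₁.g) (hS₂ : S₂.ShortExact) (h₁ : Epi φ.τ₁) (h₂ : IsIso φ.τ₂) :
    IsIso φ.τ₃ := by
  have hg := hS₂.epi_g
  have hmono : Mono φ.τ₃ := ShortComplex.mono_of_epi_of_epi_of_mono φ hS₂.exact hS₁ h₁ inferInstance
  have hepi : Epi φ.τ₃ := epi_of_epi_fac φ.comm₂₃.symm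
  exact isIso_of_mono_of_epi _

theorem mono_map_iff_of_natTrans {A B : Type*} [Category A] [Category B] {F G : A ⥤ B} (α : F ⟶ G)
    {X Y : A} {f : X ⟶ Y} (hX : IsIso (α.app X)) (hY : IsIso (α.app Y)) :
    Mono (F.map f) ↔ Mono (G.map f) :=
  (MorphismProperty.monomorphisms B).arrow_mk_iso_iff <|
    Arrow.isoMk (@asIso _ _ _ _ _ hX) (@asIso _ _ _ _ _ hY) (α.naturality f).symm

theorem epi_app_of_natTrans {A B : Type*} [Category A] [Category B] {F G : A ⥤ B} (α : F ⟶ G)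
    {X Y : A} {f : X ⟶ Y} (hX : Epi (α.app X)) (hf : Epi (G.map f)) : Epi (α.app Y) :=
  have := epi_comp' hX hf
  epi_of_epi_fac (α.naturality f)

end NaturalTransformation

/-! ### Cycles of an acyclic complex -/

section Cycles

variable {A B : Type*} [Category A] [Abelian A] [Category B] [Abelian B]

theorem exact_comp_iff_epi {X Y Z W : A} {p : X ⟶ Y} {m : Y ⟶ Z} {g : Z ⟶ W} {f : X ⟶ Z} [Mono m]
    {w : m ≫ g = 0} (hm : (ShortComplex.mk m g w).Exact) (hf : p ≫ m = f) {w' : f ≫ g = 0} :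
    (ShortComplex.mk f g w').Exact ↔ Epi p := by
  subst hf
  constructor
  · intro h
    refine (epi_iff_surjective_up_to_refinements p).2 fun T y => ?_
    obtain ⟨T', π, hπ, x, hx⟩ := h.exact_up_to_refinements (y ≫ m) (by simp [w])
    exact ⟨T', π, hπ, x, by simpa [← cancel_mono m] using hx⟩
  · intro hp
    let φ : ShortComplex.mk (p ≫ m) g w' ⟶ ShortComplex.mk m g w :=
      { τ₁ := p, τ₂ := 𝟙 _, τ₃ := 𝟙 _ }
    have : Epi φ.τ₁ := hp
    have : IsIso φ.τ₂ := inferInstanceAs (IsIso (𝟙 _))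
    have : Mono φ.τ₃ := inferInstanceAs (Mono (𝟙 _))
    exact (ShortComplex.exact_iff_of_epi_of_isIso_of_mono φ).2 hm

theorem exact_comp_mono_iff {X Y Z W : A} {f : X ⟶ Y} {q : Y ⟶ Z} {m : Z ⟶ W} {g : Y ⟶ W} [Mono m]
    {w : f ≫ q = 0} (hg : q ≫ m = g) {w' : f ≫ g = 0} :
    (ShortComplex.mk f g w').Exact ↔ (ShortComplex.mk f q w).Exact := by
  let φ : ShortComplex.mk f q w ⟶ ShortComplex.mk f g w' :=
    { τ₁ := 𝟙 _, τ₂ := 𝟙 _, τ₃ := m }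
  have : Epi φ.τ₁ := inferInstanceAs (Epi (𝟙 _))
  have : IsIso φ.τ₂ := inferInstanceAs (IsIso (𝟙 _))
  have : Mono φ.τ₃ := inferInstanceAs (Mono m)
  exact (ShortComplex.exact_iff_of_epi_of_isIso_of_mono φ).symm

variable (K : CochainComplex A ℤ)

/-- The sequence `Zⁱ → Kⁱ → Zʲ` of a cochain complex `K` with cycles `Z`, which is of interest for
`j = i + 1` only. -/
noncomputable abbrev cyclesSequence (i j : ℤ) : ShortComplex A where
  X₁ := K.cycles i
  X₂ := K.X i
  X₃ := K.cycles j
  f := K.iCycles i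
  g := K.toCycles i j
  zero := by simp [← cancel_mono (K.iCycles j)]

variable {K}

theorem exact_iCycles_d (i j : ℤ) (hij : i + 1 = j) :
    (ShortComplex.mk (K.iCycles i) (K.d i j) (by simp)).Exact :=
  ShortComplex.exact_of_f_is_kernel _ (K.cyclesIsKernel i j (by simp [hij]))

theorem cyclesSequence_shortExact (hK : K.Acyclic) {i j : ℤ} (hij : i + 1 = j) :
    (cyclesSequence K i j).ShortExact where
  exact := (exact_comp_mono_iff (K.toCycles_i i j)).1 (exact_iCycles_d i j hij)
  mono_f := inferInstanceAs (Mono (K.iCycles i))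
  epi_g := (exact_comp_iff_epi (exact_iCycles_d j (j + 1) rfl) (K.toCycles_i i j)).1 <|
    (K.exactAt_iff' i j (j + 1) (by simp [← hij]) (by simp)).1 (hK j)

theorem acyclic_map_of_shortExact_map_cyclesSequence (F : A ⥤ B) [F.Additive]
    (h : ∀ i j : ℤ, i + 1 = j → ((cyclesSequence K i j).map F).ShortExact) :
    ((F.mapHomologicalComplex (ComplexShape.up ℤ)).obj K).Acyclic := by
  intro j
  have map_toCycles_iCycles (i j : ℤ) :
      F.map (K.toCycles i j) ≫ F.map (K.iCycles j) = F.map (K.d i j) := by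
    rw [← F.map_comp, K.toCycles_i]
  have h₀ : Epi (F.map (K.toCycles (j - 1) j)) := (h (j - 1) j (by lia)).epi_g
  have h₁ : Mono (F.map (K.iCycles j)) := (h j (j + 1) rfl).mono_f
  have h₂ : Mono (F.map (K.iCycles (j + 1))) := (h (j + 1) (j + 1 + 1) rfl).mono_f
  rw [HomologicalComplex.exactAt_iff' _ (j - 1) j (j + 1) (by simp) (by simp)]
  have hd : F.map (K.d (j - 1) j) ≫ F.map (K.toCycles j (j + 1)) = 0 := by
    rw [← F.map_comp, K.d_toCycles, F.map_zero]
  refine (exact_comp_mono_iff (w := hd) (map_toCycles_iCycles j (j + 1))).2 ?_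
  exact (exact_comp_iff_epi (h j (j + 1) rfl).exact (map_toCycles_iCycles (j - 1) j)).2 h₀

theorem shortExact_map_cyclesSequence_of_acyclic_map (F : A ⥤ B) [F.Additive]
    [Limits.PreservesFiniteLimits F] (hK : K.Acyclic)
    (hFK : ((F.mapHomologicalComplex (ComplexShape.up ℤ)).obj K).Acyclic) {i j : ℤ}
    (hij : i + 1 = j) : ((cyclesSequence K i j).map F).ShortExact where
  exact := (cyclesSequence_shortExact hK hij).exact.map_of_mono_of_preservesKernel F
    (cyclesSequence_shortExact hK hij).mono_f inferInstance
  mono_f := inferInstanceAs (Mono (F.map (K.iCycles i)))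
  epi_g := by
    have hj := (exact_iCycles_d (K := K) j (j + 1) rfl).map_of_mono_of_preservesKernel F
      (inferInstanceAs (Mono (K.iCycles j))) inferInstance
    have hd : F.map (K.toCycles i j) ≫ F.map (K.iCycles j) = F.map (K.d i j) := by
      rw [← F.map_comp, K.toCycles_i]
    exact (exact_comp_iff_epi hj hd).1 <|
      (HomologicalComplex.exactAt_iff' _ i j (j + 1) (by simp [← hij]) (by simp)).1 (hFK j)

end Cycles

/-! ### Modules -/

section Modules

variable {R : Type u} [CommRing R]

theorem rTensorHomToHomRTensor_bijective_of_flat (M N F : Type u) [AddCommGroup M] [Module R M]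
    [AddCommGroup N] [Module R N] [AddCommGroup F] [Module R F] [Module.FinitePresentation R M]
    [Module.Flat R F] :
    Function.Bijective (TensorProduct.rTensorHomToHomRTensor (.id R) M N F) := by
  obtain ⟨n, m, f, g, hf, hgf⟩ := Module.FinitePresentation.exists_fin' R M
  have free (k : ℕ) :
      Function.Bijective (TensorProduct.rTensorHomToHomRTensor (.id R) (Fin k → R) N F) := by
    rw [← rTensorHomEquivHomRTensor_toLinearMap]
    exact LinearEquiv.bijective _
  have exact_hom (X : Type u) [AddCommGroup X] [Module R X] :
      Function.Exact (LinearMap.lcomp R X f) (LinearMap.lcomp R X g) :=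
    LinearMap.exact_lcomp_of_exact_of_surjective X hgf hf
  have injective_hom (X : Type u) [AddCommGroup X] [Module R X] :
      Function.Injective (LinearMap.lcomp R X f) :=
    LinearMap.lcomp_injective_of_surjective f hf
  exact LinearMap.bijective_of_bijective_of_injective_of_left_exact
    ((LinearMap.lcomp R N f).rTensor F) ((LinearMap.lcomp R N g).rTensor F)
    (LinearMap.lcomp R (N ⊗[R] F) f) (LinearMap.lcomp R (N ⊗[R] F) g) _ _ _
    (by ext; simp) (by ext; simp) (Module.Flat.rTensor_exact F (exact_hom N))
    (exact_hom (N ⊗[R] F)) (free n) (free m).injective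
    (Module.Flat.rTensor_preserves_injective_linearMap _ (injective_hom N))
    (injective_hom (N ⊗[R] F))

section Injective

variable {A B D : Type u} (I : Type u) [AddCommGroup A] [Module R A] [AddCommGroup B] [Module R B]
  [AddCommGroup D] [Module R D] [AddCommGroup I] [Module R I] [Module.Injective R I]

theorem lcomp_surjective_of_injective {f : A →ₗ[R] B} (hf : Function.Injective f) :
    Function.Surjective (LinearMap.lcomp R I f) := fun φ =>
  (Module.Injective.out f hf φ).imp fun _ h => LinearMap.ext h

theorem exact_lcomp_of_injective {f : A →ₗ[R] B} {g : B →ₗ[R] D} (h : Function.Exact f g) :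
    Function.Exact (LinearMap.lcomp R I g) (LinearMap.lcomp R I f) := by
  have hex : Function.Exact f g.rangeRestrict := fun x => by
    rw [← h x, ← Subtype.val_inj]; rfl
  intro φ
  rw [LinearMap.exact_lcomp_of_exact_of_surjective I hex g.surjective_rangeRestrict φ]
  constructor
  · rintro ⟨ψ, rfl⟩
    obtain ⟨χ, rfl⟩ := lcomp_surjective_of_injective I (LinearMap.range g).injective_subtype ψ
    exact ⟨χ, rfl⟩
  · rintro ⟨χ, rfl⟩
    exact ⟨χ ∘ₗ (LinearMap.range g).subtype, rfl⟩

end Injective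

section HomEvaluation

variable (M N I : Type u) [AddCommGroup M] [Module R M] [AddCommGroup N] [Module R N]
  [AddCommGroup I] [Module R I]

/-- The evaluation map `M ⊗ Hom(N, I) → Hom(Hom(M, N), I)`, `m ⊗ f ↦ (h ↦ f (h m))`. -/
noncomputable def homEvaluation : M ⊗[R] (N →ₗ[R] I) →ₗ[R] (M →ₗ[R] N) →ₗ[R] I :=
  TensorProduct.lift ((LinearMap.llcomp R (M →ₗ[R] N) N I).flip.comp LinearMap.applyₗ)

@[simp]
theorem homEvaluation_tmul (m : M) (f : N →ₗ[R] I) (h : M →ₗ[R] N) :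
    homEvaluation M N I (m ⊗ₜ f) h = f (h m) := rfl

theorem homEvaluation_pi_bijective (n : ℕ) :
    Function.Bijective (homEvaluation (R := R) (Fin n → R) N I) := by
  let e : (Fin n → R) ⊗[R] (N →ₗ[R] I) ≃ₗ[R] ((Fin n → R) →ₗ[R] N) →ₗ[R] I :=
    TensorProduct.comm R _ _ ≪≫ₗ TensorProduct.piScalarRight R R (N →ₗ[R] I) (Fin n) ≪≫ₗ
      LinearMap.lsum R (fun _ => N) R ≪≫ₗ
      (LinearEquiv.piRing R N (Fin n) R).symm.arrowCongr (.refl R I)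
  have he : homEvaluation (Fin n → R) N I = e.toLinearMap := by
    ext i f h
    suffices f (h (Pi.single i 1)) = ∑ c, (if c = i then f else 0) (h (Pi.single c 1)) by
      simpa [e, Pi.single_apply]
    rw [Finset.sum_eq_single i] <;> simp +contextual
  rw [he]
  exact e.bijective

theorem homEvaluation_bijective_of_injective [Module.FinitePresentation R M]
    [Module.Injective R I] : Function.Bijective (homEvaluation (R := R) M N I) := by
  obtain ⟨n, m, f, g, hf, hgf⟩ := Module.FinitePresentation.exists_fin' R M
  exact LinearMap.bijective_of_surjective_of_bijective_of_right_exact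
    (g.rTensor (N →ₗ[R] I)) (f.rTensor (N →ₗ[R] I))
    (LinearMap.lcomp R I (LinearMap.lcomp R N g)) (LinearMap.lcomp R I (LinearMap.lcomp R N f))
    (homEvaluation _ N I) (homEvaluation _ N I) _
    (by ext; simp) (by ext; simp)
    (rTensor_exact _ hgf hf)
    (exact_lcomp_of_injective I (LinearMap.exact_lcomp_of_exact_of_surjective N hgf hf))
    (homEvaluation_pi_bijective N I _).surjective (homEvaluation_pi_bijective N I _)
    (LinearMap.rTensor_surjective _ hf)
    (lcomp_surjective_of_injective I (LinearMap.lcomp_injective_of_surjective f hf))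

end HomEvaluation

end Modules

section SubsingletonHom

variable {R C K : Type*} [CommRing R] [AddCommGroup C] [Module R C] [AddCommGroup K] [Module R K]
  [Subsingleton (C →ₗ[R] K)]

theorem smul_eq_zero_of_subsingleton_hom {x : C} {y : K} {a : R}
    (ha : ∀ c : C, a • c ∈ Submodule.span R {x}) (hxy : ∀ r : R, r • x = 0 → r • y = 0) :
    a • y = 0 := by
  -- `ψ` sends `c` to `r • y`, where `a • c = r • x`.
  let φ := LinearPMap.mkSpanSingleton' (σ := .id R) x y hxy
  let ψ : C →ₗ[R] K := φ.toFun ∘ₗ (LinearMap.lsmul R C a).codRestrict _ ha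
  calc a • y = ψ x := (LinearPMap.mkSpanSingleton'_apply (σ := .id R) x y hxy a _).symm
    _ = 0 := by rw [Subsingleton.elim ψ 0, LinearMap.zero_apply]

theorem eq_zero_of_annihilator_quotient_sup_span_singleton {N : Submodule R C} {x : C}
    (hN : ∀ y : K, (∀ a ∈ Module.annihilator R (C ⧸ N ⊔ Submodule.span R {x}), a • y = 0) → y = 0)
    {y : K} (hy : ∀ a ∈ Module.annihilator R (C ⧸ N), a • y = 0) : y = 0 := by
  have mem_annihilator {L : Submodule R C} {a : R} :
      a ∈ Module.annihilator R (C ⧸ L) ↔ ∀ c : C, a • c ∈ L := by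
    simp [Submodule.annihilator_quotient, Submodule.mem_colon]
  have : Subsingleton (C ⧸ N →ₗ[R] K) :=
    (show Function.Injective (LinearMap.lcomp R K N.mkQ) from
      LinearMap.lcomp_injective_of_surjective _ N.mkQ_surjective).subsingleton
  have hmem (c : C) : c ∈ N ⊔ Submodule.span R {x} ↔ N.mkQ c ∈ Submodule.span R {N.mkQ x} := by
    rw [← Set.image_singleton, ← Submodule.map_span, ← Submodule.mem_comap,
      Submodule.comap_map_mkQ]
  refine hN y fun a ha => smul_eq_zero_of_subsingleton_hom (x := N.mkQ x) ?_ fun b hb => ?_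
  · intro c
    obtain ⟨c, rfl⟩ := N.mkQ_surjective c
    rw [← map_smul, ← hmem]
    exact mem_annihilator.1 ha c
  · refine hN (b • y) fun a ha => ?_
    rw [smul_smul]
    refine hy _ (mem_annihilator.2 fun c => ?_)
    obtain ⟨n, hn, z, hz, h⟩ := Submodule.mem_sup.1 (mem_annihilator.1 ha c)
    obtain ⟨r, rfl⟩ := Submodule.mem_span_singleton.1 hz
    rw [mul_comm a b, mul_smul, ← h, smul_add, smul_comm b r x]
    refine N.add_mem (N.smul_mem b hn) (N.smul_mem r ?_)
    rwa [← map_smul, Submodule.mkQ_apply, Submodule.Quotient.mk_eq_zero] at hb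

theorem eq_zero_of_annihilator_quotient_sup {L : Submodule R C} (hL : L.FG) {N : Submodule R C}
    (hN : ∀ y : K, (∀ a ∈ Module.annihilator R (C ⧸ N ⊔ L), a • y = 0) → y = 0)
    {y : K} (hy : ∀ a ∈ Module.annihilator R (C ⧸ N), a • y = 0) : y = 0 := by
  induction L, hL using Submodule.fg_induction generalizing N y with
  | singleton x => exact eq_zero_of_annihilator_quotient_sup_span_singleton hN hy
  | sup L₁ L₂ _ _ h₁ h₂ => exact h₁ (fun _ => h₂ (by rwa [sup_assoc])) hy

variable (R C) in
theorem subsingleton_of_subsingleton_hom [Module.Finite R C] [FaithfulSMul R C] :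
    Subsingleton K := by
  refine subsingleton_of_forall_eq 0 fun y => ?_
  refine eq_zero_of_annihilator_quotient_sup (R := R) (C := C) (N := ⊥) Module.Finite.fg_top
    (fun y hy => ?_) fun a ha => ?_
  · rw [← one_smul R y]
    exact hy 1 (by simp [Submodule.annihilator_quotient])
  · have : Module.annihilator R (C ⧸ (⊥ : Submodule R C)) = ⊥ := by
      rw [(Submodule.quotEquivOfEqBot ⊥ rfl).annihilator_eq]
      exact Module.annihilator_eq_bot.2 ‹_›
    rw [this] at ha
    rw [(Submodule.mem_bot R).1 ha, zero_smul]

end SubsingletonHom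

section ExactSequences

variable {R A B B' D : Type*} [CommRing R] [AddCommGroup A] [Module R A] [AddCommGroup B]
  [Module R B] [AddCommGroup B'] [Module R B'] [AddCommGroup D] [Module R D]

theorem exact_comp_iff_injective {f : A →ₗ[R] B} {p : B →ₗ[R] B'} (hfp : Function.Exact f p)
    (hp : Function.Surjective p) (h : B' →ₗ[R] D) :
    Function.Exact f (h ∘ₗ p) ↔ Function.Injective h := by
  rw [LinearMap.exact_iff, ← LinearMap.ker_eq_bot, LinearMap.ker_comp, ← hfp.linearMap_ker_eq,
    LinearMap.ker, ← Submodule.comap_bot (f := p),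
    (Submodule.comap_injective_of_surjective hp).eq_iff]

theorem exact_comp_iff_surjective {j : B' →ₗ[R] B} {f : B →ₗ[R] D} (hjf : Function.Exact j f)
    (hj : Function.Injective j) (h : A →ₗ[R] B') :
    Function.Exact (j ∘ₗ h) f ↔ Function.Surjective h := by
  rw [LinearMap.exact_iff, ← LinearMap.range_eq_top, LinearMap.range_comp, hjf.linearMap_ker_eq,
    LinearMap.range_eq_map j, (Submodule.map_injective_of_injective hj).eq_iff, eq_comm]

theorem rTensor_exact_iff_lcomp_exact (C : Type*) [AddCommGroup C] [Module R C] {f : A →ₗ[R] B}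
    {g : B →ₗ[R] D} (hgf : g ∘ₗ f = 0) :
    Function.Exact (f.rTensor C) (g.rTensor C) ↔
      Function.Exact (LinearMap.lcomp R (CharacterModule C) g)
        (LinearMap.lcomp R (CharacterModule C) f) := by
  let p := (LinearMap.range f).mkQ
  have hp : Function.Surjective p := Submodule.mkQ_surjective _
  have hfp : Function.Exact f p := LinearMap.exact_map_mkQ_range f
  let h : (B ⧸ LinearMap.range f) →ₗ[R] D :=
    (LinearMap.range f).liftQ g (LinearMap.range_le_ker_iff.2 hgf)
  have hg : h ∘ₗ p = g := Submodule.liftQ_mkQ _ _ _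
  rw [← hg, LinearMap.rTensor_comp, exact_comp_iff_injective (rTensor_exact C hfp hp)
    (LinearMap.rTensor_surjective C hp), rTensor_injective_iff_lcomp_surjective]
  exact (exact_comp_iff_surjective
    (LinearMap.exact_lcomp_of_exact_of_surjective (CharacterModule C) hfp hp)
    (LinearMap.lcomp_injective_of_surjective p hp) _).symm

end ExactSequences

/-! ### Vanishing of Ext and Tor -/

section ExtTor

variable {R : Type u} [CommRing R] {C M X Y : ModuleCat.{u} R}

theorem subsingleton_ext_succ_iff (P : ProjectiveResolution X) (i : ℕ) :
    Subsingleton (Abelian.Ext.{u} X Y (i + 1)) ↔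
      Function.Exact (LinearMap.lcomp R Y (P.complex.d (i + 1) i).hom)
        (LinearMap.lcomp R Y (P.complex.d (i + 2) (i + 1)).hom) := by
  have ext_eq_zero_iff (f : P.complex.X (i + 1) ⟶ Y) (hf : P.complex.d (i + 2) (i + 1) ≫ f = 0) :
      P.extMk f (i + 2) rfl hf = 0 ↔ ∃ g : P.complex.X i ⟶ Y, P.complex.d (i + 1) i ≫ g = f :=
    P.extMk_eq_zero_iff f (i + 2) rfl hf i rfl
  constructor
  · refine fun h => LinearMap.exact_of_comp_of_mem_range ?_ fun f hf => ?_
    · ext f : 1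
      exact congrArg ModuleCat.Hom.hom (P.complex.d_comp_d_assoc (i + 2) (i + 1) i
        (ModuleCat.ofHom f)) |>.trans (by simp)
    · obtain ⟨g, hg⟩ := (ext_eq_zero_iff (ModuleCat.ofHom f) (ModuleCat.hom_ext hf)).1
        (Subsingleton.elim _ _)
      exact ⟨g.hom, congrArg ModuleCat.Hom.hom hg⟩
  · refine fun h => subsingleton_of_forall_eq 0 fun α => ?_
    obtain ⟨f, hf, rfl⟩ := P.extMk_surjective α (i + 2) rfl
    obtain ⟨g, hg⟩ := (h f.hom).1 (congrArg ModuleCat.Hom.hom hf)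
    exact (ext_eq_zero_iff f hf).2 ⟨ModuleCat.ofHom g, ModuleCat.hom_ext hg⟩

theorem isZero_tor_succ_iff (P : ProjectiveResolution M) (i : ℕ) :
    Limits.IsZero (((Tor (ModuleCat.{u} R) (i + 1)).obj C).obj M) ↔
      Function.Exact ((P.complex.d (i + 2) (i + 1)).hom.lTensor C)
        ((P.complex.d (i + 1) i).hom.lTensor C) := by
  refine (P.isoLeftDerivedObj (tensorFunctor C) (i + 1)).isZero_iff.trans ?_
  refine (HomologicalComplex.exactAt_iff_isZero_homology _ (i + 1)).symm.trans ?_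
  rw [HomologicalComplex.exactAt_iff' _ (i + 2) (i + 1) i (by simp) (by simp),
    ShortComplex.ShortExact.moduleCat_exact_iff_function_exact]
  rfl

theorem isZero_tor_succ_iff_subsingleton_ext (i : ℕ) :
    Limits.IsZero (((Tor (ModuleCat.{u} R) (i + 1)).obj C).obj M) ↔
      Subsingleton (Abelian.Ext.{u} M (ModuleCat.of R (CharacterModule C)) (i + 1)) := by
  have P := projectiveResolution M
  rw [isZero_tor_succ_iff P, subsingleton_ext_succ_iff P,
    ← LinearMap.rTensor_exact_iff_lTensor_exact, rTensor_exact_iff_lcomp_exact]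
  exact congrArg ModuleCat.Hom.hom (P.complex.d_comp_d _ _ _)

theorem torVanish_iff_extVanish :
    TorVanish C M ↔ ExtVanish M (ModuleCat.of R (CharacterModule C)) :=
  forall_congr' fun i => forall_congr' fun hi => by
    obtain ⟨i, rfl⟩ := Nat.exists_eq_add_of_le' hi
    exact isZero_tor_succ_iff_subsingleton_ext i

theorem mono_map_tensorFunctor_iff {A B : ModuleCat.{u} R} (f : A ⟶ B) :
    Mono ((tensorFunctor C).map f) ↔
      ∀ g : A ⟶ ModuleCat.of R (CharacterModule C), ∃ h, f ≫ h = g := by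
  rw [ModuleCat.mono_iff_injective]
  refine (LinearMap.lTensor_inj_iff_rTensor_inj ..).trans ?_
  rw [rTensor_injective_iff_lcomp_surjective]
  constructor
  · intro h g
    obtain ⟨k, hk⟩ := h g.hom
    exact ⟨ModuleCat.ofHom k, ModuleCat.hom_ext hk⟩
  · intro h g
    obtain ⟨k, hk⟩ := h (ModuleCat.ofHom g)
    exact ⟨k.hom, congrArg ModuleCat.Hom.hom hk⟩

theorem ExtVanish.of_iso {Y' : ModuleCat.{u} R} (e : Y ≅ Y') (h : ExtVanish X Y) :
    ExtVanish X Y' := by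
  intro i hi
  have : Subsingleton ((Abelian.extFunctorObj X i).obj Y) := h i hi
  exact ((Abelian.extFunctorObj X i).mapIso e).addCommGroupIsoToAddEquiv.symm.subsingleton

end ExtTor

section LongExactSequence

variable {R : Type u} [CommRing R] {S : ShortComplex (ModuleCat.{u} R)} (hS : S.ShortExact)
  {X Y : ModuleCat.{u} R}

include hS

theorem ExtVanish.left_X₁ (h₂ : ExtVanish S.X₂ Y) (h₃ : ExtVanish S.X₃ Y) :
    ExtVanish S.X₁ Y := fun i hi => by
  have := h₂ i hi
  have := h₃ (i + 1) (by lia)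
  refine subsingleton_of_forall_eq 0 fun α => ?_
  obtain ⟨β, rfl⟩ := Abelian.Ext.contravariant_sequence_exact₁ hS _ α (add_comm 1 i)
    (Subsingleton.elim _ _)
  rw [Subsingleton.elim β 0, Abelian.Ext.comp_zero]

theorem ExtVanish.right_X₃ (h₁ : ExtVanish X S.X₁) (h₂ : ExtVanish X S.X₂) :
    ExtVanish X S.X₃ := fun i hi => by
  have := h₁ (i + 1) (by lia)
  have := h₂ i hi
  refine subsingleton_of_forall_eq 0 fun α => ?_
  obtain ⟨β, rfl⟩ := Abelian.Ext.covariant_sequence_exact₃ _ hS α rfl (Subsingleton.elim _ _)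
  rw [Subsingleton.elim β 0, Abelian.Ext.zero_comp]

theorem ExtVanish.exists_extension (h₃ : ExtVanish S.X₃ Y) (f : S.X₁ ⟶ Y) :
    ∃ g : S.X₂ ⟶ Y, S.f ≫ g = f := by
  have := h₃ 1 le_rfl
  obtain ⟨β, hβ⟩ := Abelian.Ext.contravariant_sequence_exact₁ hS _ (Abelian.Ext.mk₀ f) rfl
    (Subsingleton.elim _ _)
  obtain ⟨g, rfl⟩ := (Abelian.Ext.mk₀_bijective _ _).2 β
  rw [Abelian.Ext.mk₀_comp_mk₀] at hβ
  exact ⟨g, (Abelian.Ext.mk₀_bijective _ _).1 hβ⟩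

theorem ExtVanish.exists_lift (h₁ : ExtVanish X S.X₁) (f : X ⟶ S.X₃) :
    ∃ g : X ⟶ S.X₂, g ≫ S.g = f := by
  have := h₁ 1 le_rfl
  obtain ⟨β, hβ⟩ := Abelian.Ext.covariant_sequence_exact₃ _ hS (Abelian.Ext.mk₀ f) rfl
    (Subsingleton.elim _ _)
  obtain ⟨g, rfl⟩ := (Abelian.Ext.mk₀_bijective _ _).2 β
  rw [Abelian.Ext.mk₀_comp_mk₀] at hβ
  exact ⟨g, (Abelian.Ext.mk₀_bijective _ _).1 hβ⟩

theorem subsingleton_ext_succ_X₃ {i : ℕ} (h₂ : Subsingleton (Abelian.Ext.{u} S.X₂ Y (i + 1)))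
    (hf : Function.Surjective fun β : Abelian.Ext.{u} S.X₂ Y i =>
      (Abelian.Ext.mk₀ S.f).comp β (zero_add i)) :
    Subsingleton (Abelian.Ext.{u} S.X₃ Y (i + 1)) := by
  refine subsingleton_of_forall_eq 0 fun α => ?_
  obtain ⟨β, rfl⟩ := Abelian.Ext.contravariant_sequence_exact₃ hS _ α (Subsingleton.elim _ _)
    (add_comm 1 i)
  obtain ⟨γ, rfl⟩ := hf β
  rw [← Abelian.Ext.comp_assoc _ _ _ rfl (zero_add i) (by lia)]
  simp

theorem subsingleton_ext_succ_X₁ {i : ℕ} (h₂ : Subsingleton (Abelian.Ext.{u} X S.X₂ (i + 1)))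
    (hg : Function.Surjective fun β : Abelian.Ext.{u} X S.X₂ i =>
      β.comp (Abelian.Ext.mk₀ S.g) (add_zero i)) :
    Subsingleton (Abelian.Ext.{u} X S.X₁ (i + 1)) := by
  refine subsingleton_of_forall_eq 0 fun α => ?_
  obtain ⟨β, rfl⟩ := Abelian.Ext.covariant_sequence_exact₁ _ hS α (Subsingleton.elim _ _) rfl
  obtain ⟨γ, rfl⟩ := hg β
  rw [Abelian.Ext.comp_assoc _ _ _ (add_zero i) (zero_add 1) (by lia)]
  simp

end LongExactSequence

section DimensionShift

variable {R : Type u} [CommRing R] {X Y : ModuleCat.{u} R} {P : ObjectProperty (ModuleCat.{u} R)}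

theorem extVanish_left_of_dimension_shift
    (hP : ∀ M, P M → ∃ (K L : ModuleCat.{u} R) (f : K ⟶ L) (g : L ⟶ M) (w : f ≫ g = 0),
      (ShortComplex.mk f g w).ShortExact ∧ P K ∧ ExtVanish L Y ∧
        ∀ a : K ⟶ Y, ∃ b : L ⟶ Y, f ≫ b = a)
    {M : ModuleCat.{u} R} (hM : P M) : ExtVanish M Y := fun i hi => by
  obtain ⟨i, rfl⟩ := Nat.exists_eq_add_of_le' hi
  induction i generalizing M with
  | zero =>
    obtain ⟨K, L, f, g, w, hS, -, hL, hf⟩ := hP M hM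
    refine subsingleton_ext_succ_X₃ hS (hL 1 le_rfl) fun α => ?_
    obtain ⟨a, rfl⟩ := (Abelian.Ext.mk₀_bijective _ _).2 α
    obtain ⟨b, rfl⟩ := hf a
    exact ⟨.mk₀ b, Abelian.Ext.mk₀_comp_mk₀ _ _⟩
  | succ i ih =>
    obtain ⟨K, L, f, g, w, hS, hK, hL, -⟩ := hP M hM
    have := ih hK (by lia)
    exact subsingleton_ext_succ_X₃ hS (hL _ (by lia)) fun α => ⟨0, Subsingleton.elim _ _⟩

theorem extVanish_right_of_dimension_shift
    (hP : ∀ M, P M → ∃ (L N : ModuleCat.{u} R) (f : M ⟶ L) (g : L ⟶ N) (w : f ≫ g = 0),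
      (ShortComplex.mk f g w).ShortExact ∧ P N ∧ ExtVanish X L ∧
        ∀ a : X ⟶ N, ∃ b : X ⟶ L, b ≫ g = a)
    {M : ModuleCat.{u} R} (hM : P M) : ExtVanish X M := fun i hi => by
  obtain ⟨i, rfl⟩ := Nat.exists_eq_add_of_le' hi
  induction i generalizing M with
  | zero =>
    obtain ⟨L, N, f, g, w, hS, -, hL, hg⟩ := hP M hM
    refine subsingleton_ext_succ_X₁ hS (hL 1 le_rfl) fun α => ?_
    obtain ⟨a, rfl⟩ := (Abelian.Ext.mk₀_bijective _ _).2 α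
    obtain ⟨b, rfl⟩ := hg a
    exact ⟨.mk₀ b, Abelian.Ext.mk₀_comp_mk₀ _ _⟩
  | succ i ih =>
    obtain ⟨L, N, f, g, w, hS, hN, hL, -⟩ := hP M hM
    have := ih hN (by lia)
    exact subsingleton_ext_succ_X₁ hS (hL _ (by lia)) fun α => ⟨0, Subsingleton.elim _ _⟩

end DimensionShift

section Tor

variable {R : Type u} [CommRing R] {C : ModuleCat.{u} R}

theorem torVanish_of_dimension_shift {P : ObjectProperty (ModuleCat.{u} R)}
    (hP : ∀ M, P M → ∃ (K L : ModuleCat.{u} R) (f : K ⟶ L) (g : L ⟶ M) (w : f ≫ g = 0),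
      (ShortComplex.mk f g w).ShortExact ∧ P K ∧ TorVanish C L ∧ Mono ((tensorFunctor C).map f))
    {M : ModuleCat.{u} R} (hM : P M) : TorVanish C M :=
  torVanish_iff_extVanish.2 <| extVanish_left_of_dimension_shift (P := P) (fun M hM => by
    obtain ⟨K, L, f, g, w, hS, hK, hL, hf⟩ := hP M hM
    exact ⟨K, L, f, g, w, hS, hK, torVanish_iff_extVanish.1 hL,
      (mono_map_tensorFunctor_iff f).1 hf⟩) hM

theorem shortExact_map_tensorFunctor {S : ShortComplex (ModuleCat.{u} R)} (hS : S.ShortExact)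
    (hf : Mono ((tensorFunctor C).map S.f)) : (S.map (tensorFunctor C)).ShortExact :=
  have hg : Function.Surjective S.g.hom := (ModuleCat.epi_iff_surjective S.g).1 hS.epi_g
  { exact := (ShortComplex.ShortExact.moduleCat_exact_iff_function_exact _).2 <|
      lTensor_exact C ((ShortComplex.ShortExact.moduleCat_exact_iff_function_exact S).1 hS.exact) hg
    mono_f := hf
    epi_g := (ModuleCat.epi_iff_surjective _).2 (LinearMap.lTensor_surjective C hg) }

theorem TorVanish.shortExact_map {S : ShortComplex (ModuleCat.{u} R)} (hS : S.ShortExact)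
    (h₃ : TorVanish C S.X₃) : (S.map (tensorFunctor C)).ShortExact :=
  shortExact_map_tensorFunctor hS <|
    (mono_map_tensorFunctor_iff S.f).2 ((torVanish_iff_extVanish.1 h₃).exists_extension hS)

theorem TorVanish.X₁ {S : ShortComplex (ModuleCat.{u} R)} (hS : S.ShortExact)
    (h₂ : TorVanish C S.X₂) (h₃ : TorVanish C S.X₃) : TorVanish C S.X₁ := by
  rw [torVanish_iff_extVanish] at *
  exact h₂.left_X₁ hS h₃

theorem TorVanish.of_iso {M M' : ModuleCat.{u} R} (e : M ≅ M') (h : TorVanish C M) :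
    TorVanish C M' :=
  fun i hi => (h i hi).of_iso (((Tor (ModuleCat.{u} R) i).obj C).mapIso e.symm)

theorem mono_map_tensorFunctor_of_flat {S : ShortComplex (ModuleCat.{u} R)} (hS : S.ShortExact)
    (h₃ : Module.Flat R S.X₃) : Mono ((tensorFunctor C).map S.f) := by
  rw [ModuleCat.mono_iff_injective]
  exact LinearMap.lTensor_injective_of_exact_of_flat S.g.hom
    ((ModuleCat.epi_iff_surjective S.g).1 hS.epi_g) S.f.hom
    ((ModuleCat.mono_iff_injective S.f).1 hS.mono_f)
    ((ShortComplex.ShortExact.moduleCat_exact_iff_function_exact S).1 hS.exact) C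

theorem flat_of_shortExact {S : ShortComplex (ModuleCat.{u} R)} (hS : S.ShortExact)
    (h₂ : Module.Flat R S.X₂) (h₃ : Module.Flat R S.X₃) : Module.Flat R S.X₁ := by
  rw [Module.Flat.iff_lTensor_preserves_injective_linearMap]
  intro N N' _ _ _ _ φ hφ
  have hN : Function.Injective (S.f.hom.rTensor N) := by
    rw [← LinearMap.lTensor_inj_iff_rTensor_inj]
    exact (ModuleCat.mono_iff_injective _).1
      (mono_map_tensorFunctor_of_flat (C := ModuleCat.of R N) hS h₃)
  have hφ₂ : Function.Injective (φ.lTensor S.X₂) :=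
    Module.Flat.lTensor_preserves_injective_linearMap φ hφ
  refine Function.Injective.of_comp (f := S.f.hom.rTensor N') ?_
  rw [← LinearMap.coe_comp, LinearMap.rTensor_comp_lTensor, ← LinearMap.lTensor_comp_rTensor]
  exact hφ₂.comp hN

theorem torVanish_of_projective {L : ModuleCat.{u} R} [Projective L] : TorVanish C L :=
  fun i hi => by
    obtain ⟨j, rfl⟩ := Nat.exists_eq_add_of_le' hi
    exact isZero_Tor_succ_of_projective _ C L j

theorem torVanish_of_flat {F : ModuleCat.{u} R} (hF : Module.Flat R F) : TorVanish C F := by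
  refine torVanish_of_dimension_shift (P := fun M => Module.Flat R M) (fun M hM => ?_) hF
  let L := Projective.over M
  have hL : Projective L := Projective.projective_over M
  let p : L ⟶ M := Projective.π M
  have hS : p.hom.shortComplexKer.ShortExact :=
    LinearMap.shortExact_shortComplexKer ((ModuleCat.epi_iff_surjective p).1 inferInstance)
  have hFL : Module.Flat R L :=
    have := (IsProjective.iff_projective L).2 hL
    inferInstance
  exact ⟨_, L, _, p, p.hom.shortComplexKer.zero, hS, flat_of_shortExact hS hFL hM,
    torVanish_of_projective, mono_map_tensorFunctor_of_flat hS hM⟩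

end Tor

/-! ### Semidualizing modules -/

section TensorHomAdjunction

open MonoidalCategory

variable {R : Type u} [CommRing R]

/-- The tensor-hom adjunction `C ⊗ - ⊣ Hom(C, -)`. Its unit is the evaluation map in the definition
of the Auslander class. -/
noncomputable abbrev tensorHomAdjunction (C : ModuleCat.{u} R) : tensorFunctor C ⊣ homFunctor C :=
  ihom.adjunction C

theorem isIso_unit_iff (C M : ModuleCat.{u} R) : IsIso ((tensorHomAdjunction C).unit.app M) ↔
    Function.Bijective ((TensorProduct.mk R C M).flip : M →ₗ[R] C →ₗ[R] C ⊗[R] M) := by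
  rw [ConcreteCategory.isIso_iff_bijective]
  have : ⇑((TensorProduct.mk R C M).flip : M →ₗ[R] C →ₗ[R] C ⊗[R] M) =
      ModuleCat.homLinearEquiv (S := R) (M := C) (N := ModuleCat.of R (C ⊗[R] M)) ∘
        (tensorHomAdjunction C).unit.app M := by
    ext; rfl
  rw [this]
  exact (Function.Bijective.of_comp_iff' (LinearEquiv.bijective _) _).symm

end TensorHomAdjunction

namespace IsSemidualizing

variable {R : Type u} [CommRing R] {C : ModuleCat.{u} R}

theorem finitePresentation (hC : IsSemidualizing C) : Module.FinitePresentation R C := by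
  obtain ⟨P, hP⟩ := hC.resolution
  have (n : ℕ) : Module.Projective R (P.complex.X n) :=
    (IsProjective.iff_projective _).2 (P.projective n)
  have : Module.FinitePresentation R (P.complex.X 0) := Module.finitePresentation_of_projective R _
  let p : P.complex.X 0 ⟶ C := P.π.f 0
  have hdp : Function.Exact (P.complex.d 1 0).hom p.hom :=
    (ShortComplex.ShortExact.moduleCat_exact_iff_function_exact _).1 P.exact₀
  refine Module.finitePresentation_of_surjective p.hom
    ((ModuleCat.epi_iff_surjective (P.π.f 0)).1 inferInstance) ?_
  rw [hdp.linearMap_ker_eq, LinearMap.range_eq_map]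
  exact (Module.Finite.fg_top).map _

theorem faithfulSMul (hC : IsSemidualizing C) : FaithfulSMul R C :=
  ⟨fun h => hC.homothety.injective (LinearMap.ext h)⟩

theorem isIso_unit_of_flat (hC : IsSemidualizing C) {F : ModuleCat.{u} R}
    (hF : Module.Flat R F) : IsIso ((tensorHomAdjunction C).unit.app F) := by
  have := hC.finitePresentation
  let e : R ≃ₗ[R] (C →ₗ[R] C) := LinearEquiv.ofBijective _ hC.homothety
  have h : ((TensorProduct.mk R C F).flip : F →ₗ[R] C →ₗ[R] C ⊗[R] F) =
      TensorProduct.rTensorHomToHomRTensor (.id R) C C F ∘ₗ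
        ((TensorProduct.lid R F).symm ≪≫ₗ e.rTensor F).toLinearMap := by
    ext; simp [e]
  rw [isIso_unit_iff, h, LinearMap.coe_comp]
  exact (rTensorHomToHomRTensor_bijective_of_flat C C F).comp (LinearEquiv.bijective _)

theorem isIso_counit_of_injective (hC : IsSemidualizing C) {I : ModuleCat.{u} R}
    (hI : Module.Injective R I) : IsIso ((tensorHomAdjunction C).counit.app I) := by
  have := hC.finitePresentation
  let e : R ≃ₗ[R] (C →ₗ[R] C) := LinearEquiv.ofBijective _ hC.homothety
  let e' : ((C →ₗ[R] C) →ₗ[R] I) ≃ₗ[R] I :=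
    e.symm.arrowCongr (.refl R I) ≪≫ₗ LinearMap.ringLmapEquivSelf R R I
  let e'' : (homFunctor C).obj I ≃ₗ[R] (C →ₗ[R] I) := ModuleCat.homLinearEquiv
  have h : ((tensorHomAdjunction C).counit.app I).hom =
      e'.toLinearMap ∘ₗ homEvaluation C C I ∘ₗ (e''.lTensor C).toLinearMap := by
    refine TensorProduct.ext' fun c f => ?_
    calc e'' f c = e'' f ((1 : R) • c) := by rw [one_smul]
      _ = e' (homEvaluation C C I (c ⊗ₜ e'' f)) := by simp [e', e]
  rw [ConcreteCategory.isIso_iff_bijective]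
  change Function.Bijective ((tensorHomAdjunction C).counit.app I).hom
  rw [h, LinearMap.coe_comp, LinearMap.coe_comp]
  exact e'.bijective.comp
    ((homEvaluation_bijective_of_injective C C I).comp (LinearEquiv.bijective _))

theorem extVanish_of_flat (hC : IsSemidualizing C) {F : ModuleCat.{u} R}
    (hF : Module.Flat R F) : ExtVanish C ((tensorFunctor C).obj F) := fun i hi => by
  obtain ⟨i, rfl⟩ := Nat.exists_eq_add_of_le' hi
  obtain ⟨P, hP⟩ := hC.resolution
  let e (n : ℕ) : (P.complex.X n →ₗ[R] C) ⊗[R] F ≃ₗ[R] P.complex.X n →ₗ[R] C ⊗[R] F :=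
    have : Module.Projective R (P.complex.X n) :=
      (IsProjective.iff_projective _).2 (P.projective n)
    have := Module.finitePresentation_of_projective R (P.complex.X n)
    LinearEquiv.ofBijective _ (rTensorHomToHomRTensor_bijective_of_flat (P.complex.X n) C F)
  have naturality (m n : ℕ) : LinearMap.lcomp R (C ⊗[R] F) (P.complex.d m n).hom ∘ₗ
      (e n).toLinearMap = (e m).toLinearMap ∘ₗ
        (LinearMap.lcomp R C (P.complex.d m n).hom).rTensor F := by
    ext; simp [e]
  refine (subsingleton_ext_succ_iff P i).2 ?_
  refine (Function.Exact.iff_of_ladder_linearEquiv (naturality _ _) (naturality _ _)).2 ?_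
  exact Module.Flat.rTensor_exact F <| (subsingleton_ext_succ_iff P i).1 <|
    hC.ext_vanish (i + 1) (by lia)

end IsSemidualizing

section ExactAfter

open MonoidalCategory

variable {R : Type u} [CommRing R] {C X : ModuleCat.{u} R}
  {K : CochainComplex (ModuleCat.{u} R) ℤ}

theorem exactAfter_iff_of_natTrans {F G : ModuleCat.{u} R ⥤ ModuleCat.{u} R} [F.Additive]
    [G.Additive] (α : F ⟶ G) (h : ∀ n, IsIso (α.app (K.X n))) :
    ExactAfter F K ↔ ExactAfter G K := by
  let φ := (NatTrans.mapHomologicalComplex α (ComplexShape.up ℤ)).app K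
  have hφ (n : ℤ) : IsIso (φ.f n) := h n
  have : IsIso φ := HomologicalComplex.Hom.isIso_of_components φ
  exact ⟨fun hF n => (hF n).of_iso (asIso φ), fun hG n => (hG n).of_iso (asIso φ).symm⟩

theorem preservesFiniteLimits_homFunctor (X : ModuleCat.{u} R) :
    Limits.PreservesFiniteLimits (homFunctor X) :=
  have := (tensorHomAdjunction X).rightAdjoint_preservesLimits
  inferInstance

theorem shortExact_map_homFunctor {S : ShortComplex (ModuleCat.{u} R)} (hS : S.ShortExact)
    (hg : ∀ a : X ⟶ S.X₃, ∃ b : X ⟶ S.X₂, b ≫ S.g = a) :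
    (S.map (homFunctor X)).ShortExact :=
  have := preservesFiniteLimits_homFunctor X
  have := hS.mono_f
  { exact := hS.exact.map_of_mono_of_preservesKernel _ hS.mono_f inferInstance
    mono_f := inferInstanceAs (Mono ((homFunctor X).map S.f))
    epi_g := (ModuleCat.epi_iff_surjective _).2 hg }

theorem exactAfter_homFunctor_of_projective (P : ModuleCat.{u} R) [Projective P]
    (hK : K.Acyclic) : ExactAfter (homFunctor P) K :=
  acyclic_map_of_shortExact_map_cyclesSequence _ fun _ _ hij =>
    have hS := cyclesSequence_shortExact hK hij
    have := hS.epi_g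
    shortExact_map_homFunctor hS fun a => ⟨_, Projective.factorThru_comp a _⟩

theorem forall_cProjective_exactAfter_iff :
    (∀ X, cProjective C X → ExactAfter (homFunctor X) K) ↔ ExactAfter (homFunctor C) K := by
  constructor
  · exact fun h => h C
      ⟨ModuleCat.of R R, inferInstance, ⟨(TensorProduct.rid R C).symm⟩⟩
  · rintro h X ⟨P, hP, ⟨e⟩⟩
    let α : tensorFunctor P ⋙ tensorFunctor C ≅ tensorFunctor X :=
      (tensorLeftTensor C P).symm ≪≫
        (curriedTensor (ModuleCat R)).mapIso e.symm.toModuleIso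
    let β : homFunctor X ≅ homFunctor C ⋙ homFunctor P :=
      Adjunction.rightAdjointUniq (tensorHomAdjunction X)
        (((tensorHomAdjunction P).comp (tensorHomAdjunction C)).ofNatIsoLeft α)
    have := (IsProjective.iff_projective P).1 hP
    exact (exactAfter_iff_of_natTrans β.hom fun _ => inferInstance).2
      (exactAfter_homFunctor_of_projective P h)

theorem IsSemidualizing.forall_cInjective_exactAfter_iff (hC : IsSemidualizing C) :
    (∀ J, cInjective C J → ExactAfter (tensorFunctor C ⋙ tensorFunctor J) K) ↔
      ∀ I : ModuleCat.{u} R, Module.Injective R I → ExactAfter (tensorFunctor I) K := by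
  have key {I J : ModuleCat.{u} R} (hI : Module.Injective R I) (e : J ≃ₗ[R] (C →ₗ[R] I)) :
      ExactAfter (tensorFunctor C ⋙ tensorFunctor J) K ↔ ExactAfter (tensorFunctor I) K := by
    have := hC.isIso_counit_of_injective hI
    let e' : J ≅ (homFunctor C).obj I := (e ≪≫ₗ ModuleCat.homLinearEquiv.symm).toModuleIso
    let i : J ⊗ C ≅ I := (β_ J C) ≪≫ (tensorFunctor C).mapIso e' ≪≫
      asIso ((tensorHomAdjunction C).counit.app I)
    let α : tensorFunctor C ⋙ tensorFunctor J ≅ tensorFunctor I :=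
      (tensorLeftTensor J C).symm ≪≫ (curriedTensor (ModuleCat R)).mapIso i
    exact exactAfter_iff_of_natTrans α.hom fun _ => inferInstance
  constructor
  · intro h I hI
    exact (key hI ModuleCat.homLinearEquiv).1
      (h ((homFunctor C).obj I) ⟨I, hI, ⟨ModuleCat.homLinearEquiv⟩⟩)
  · rintro h J ⟨I, hI, ⟨e⟩⟩
    exact (key hI e).2 (h I hI)

end ExactAfter

section Range

variable {R : Type u} [CommRing R] {K : CochainComplex (ModuleCat.{u} R) ℤ}

theorem nonempty_linearEquiv_range {X Y Z : ModuleCat.{u} R} (p : X ⟶ Y) (m : Y ⟶ Z) [Epi p]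
    [Mono m] : Nonempty (Y ≃ₗ[R] LinearMap.range (p ≫ m).hom) := by
  have hp := (ModuleCat.epi_iff_surjective p).1 inferInstance
  have hm := (ModuleCat.mono_iff_injective m).1 inferInstance
  exact ⟨LinearEquiv.ofInjective m.hom hm ≪≫ₗ LinearEquiv.ofEq _ _
    (LinearMap.range_comp_of_range_eq_top m.hom (LinearMap.range_eq_top.2 hp)).symm⟩

theorem nonempty_map_cycles_linearEquiv_range (F : ModuleCat.{u} R ⥤ ModuleCat.{u} R) [F.Additive]
    (h : ∀ i j : ℤ, i + 1 = j → ((cyclesSequence K i j).map F).ShortExact) :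
    Nonempty (F.obj (K.cycles 0) ≃ₗ[R] LinearMap.range (F.map (K.d (-1) 0)).hom) := by
  have : Epi (F.map (K.toCycles (-1) 0)) := (h (-1) 0 rfl).epi_g
  have : Mono (F.map (K.iCycles 0)) := (h 0 1 rfl).mono_f
  rw [← K.toCycles_i (-1) 0, F.map_comp]
  exact nonempty_linearEquiv_range _ _

theorem nonempty_cycles_linearEquiv_range (hK : K.Acyclic) :
    Nonempty (K.cycles 0 ≃ₗ[R] LinearMap.range (K.d (-1) 0).hom) :=
  nonempty_map_cycles_linearEquiv_range (𝟭 _) fun _ _ hij => cyclesSequence_shortExact hK hij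

end Range

section Auslander

variable {R : Type u} [CommRing R] {C : ModuleCat.{u} R}

theorem IsSemidualizing.mono_of_mono_map_homFunctor (hC : IsSemidualizing C)
    {X Y : ModuleCat.{u} R} {f : X ⟶ Y} (hf : Mono ((homFunctor C).map f)) : Mono f := by
  have := hC.finitePresentation
  have := hC.faithfulSMul
  have : Subsingleton (C →ₗ[R] LinearMap.ker f.hom) := by
    refine subsingleton_of_forall_eq 0 fun φ => ?_
    have h := (ModuleCat.mono_iff_injective _).1 hf
      (a₁ := ModuleCat.ofHom ((LinearMap.ker f.hom).subtype ∘ₗ φ)) (a₂ := 0)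
      (ModuleCat.hom_ext (LinearMap.ext fun c => (φ c).2.trans (map_zero f.hom).symm))
    ext c
    exact congr($(h).hom c)
  have := subsingleton_of_subsingleton_hom R C (K := LinearMap.ker f.hom)
  rw [ModuleCat.mono_iff_ker_eq_bot]
  exact Submodule.subsingleton_iff_eq_bot.1 this

theorem auslanderClass_iff {M : ModuleCat.{u} R} : auslanderClass C M ↔ TorVanish C M ∧
    ExtVanish C ((tensorFunctor C).obj M) ∧ IsIso ((tensorHomAdjunction C).unit.app M) := by
  rw [isIso_unit_iff]; rfl

theorem auslanderClass_of_iso {M M' : ModuleCat.{u} R} (e : M ≅ M') (h : auslanderClass C M) :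
    auslanderClass C M' := by
  rw [auslanderClass_iff] at *
  exact ⟨h.1.of_iso e, h.2.1.of_iso ((tensorFunctor C).mapIso e),
    (NatTrans.isIso_app_iff_of_iso _ e).1 h.2.2⟩

variable {S : ShortComplex (ModuleCat.{u} R)} (hS : S.ShortExact)

include hS

theorem IsSemidualizing.shortExact_map_tensorFunctor_of_isIso_unit (hC : IsSemidualizing C)
    (h₁ : IsIso ((tensorHomAdjunction C).unit.app S.X₁))
    (h₂ : IsIso ((tensorHomAdjunction C).unit.app S.X₂)) :
    (S.map (tensorFunctor C)).ShortExact :=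
  shortExact_map_tensorFunctor hS <| hC.mono_of_mono_map_homFunctor <|
    (mono_map_iff_of_natTrans (tensorHomAdjunction C).unit h₁ h₂).1 hS.mono_f

theorem isIso_unit_X₃ (hT : (S.map (tensorFunctor C)).ShortExact)
    (hE : ExtVanish C ((tensorFunctor C).obj S.X₁))
    (h₁ : IsIso ((tensorHomAdjunction C).unit.app S.X₁))
    (h₂ : IsIso ((tensorHomAdjunction C).unit.app S.X₂)) :
    IsIso ((tensorHomAdjunction C).unit.app S.X₃) :=
  isIso_τ₃_of_epi_of_isIso (S.mapNatTrans (tensorHomAdjunction C).unit) hS.epi_g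
    (shortExact_map_homFunctor hT (hE.exists_lift hT))
    (h₁.epi_of_iso) h₂

end Auslander

/-! ### The two functors -/

section TensorGorenstein

variable {R : Type u} [CommRing R] {C : ModuleCat.{u} R}
  {K : CochainComplex (ModuleCat.{u} R) ℤ}

theorem torVanish_cycles_of_le (hK : K.Acyclic) (hflat : ∀ n, Module.Flat R (K.X n)) {m n : ℤ}
    (hm : TorVanish C (K.cycles m)) (hn : n ≤ m) : TorVanish C (K.cycles n) := by
  induction n, hn using Int.leInductionDown with
  | base => exact hm
  | pred n _ ih =>
    exact TorVanish.X₁ (cyclesSequence_shortExact hK (sub_add_cancel n 1))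
      (torVanish_of_flat (hflat _)) ih

theorem IsSemidualizing.extVanish_and_isIso_unit_cycles_of_ge (hC : IsSemidualizing C)
    (hK : K.Acyclic) (hflat : ∀ n, Module.Flat R (K.X n)) {m n : ℤ}
    (hE : ExtVanish C ((tensorFunctor C).obj (K.cycles m)))
    (hη : IsIso ((tensorHomAdjunction C).unit.app (K.cycles m))) (hn : m ≤ n) :
    ExtVanish C ((tensorFunctor C).obj (K.cycles n)) ∧
      IsIso ((tensorHomAdjunction C).unit.app (K.cycles n)) := by
  induction n, hn using Int.leInduction with
  | base => exact ⟨hE, hη⟩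
  | succ n _ ih =>
    have hS := cyclesSequence_shortExact hK (rfl : n + 1 = n + 1)
    have h₂ := hC.isIso_unit_of_flat (hflat n)
    have hT := hC.shortExact_map_tensorFunctor_of_isIso_unit hS ih.2 h₂
    exact ⟨ih.1.right_X₃ hT (hC.extVanish_of_flat (hflat n)), isIso_unit_X₃ hS hT ih.1 ih.2 h₂⟩

theorem IsSemidualizing.shortExact_map_cyclesSequence_of_auslanderClass (hC : IsSemidualizing C)
    (hK : K.Acyclic) (hflat : ∀ n, Module.Flat R (K.X n)) {m : ℤ}
    (hM : auslanderClass C (K.cycles m)) {i j : ℤ} (hij : i + 1 = j) :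
    ((cyclesSequence K i j).map (tensorFunctor C)).ShortExact := by
  obtain ⟨htor, hext, hunit⟩ := auslanderClass_iff.1 hM
  have hS := cyclesSequence_shortExact hK hij
  obtain hj | hi : j ≤ m ∨ m ≤ i := by lia
  · exact (torVanish_cycles_of_le hK hflat htor hj).shortExact_map hS
  · exact hC.shortExact_map_tensorFunctor_of_isIso_unit hS
      (hC.extVanish_and_isIso_unit_cycles_of_ge hK hflat hext hunit hi).2
      (hC.isIso_unit_of_flat (hflat i))

theorem IsSemidualizing.wfGorenstein_tensorFunctor (hC : IsSemidualizing C) {M : ModuleCat.{u} R}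
    (hG : gorensteinFlat R M) (hA : auslanderClass C M) :
    wfGorenstein C ((tensorFunctor C).obj M) := by
  obtain ⟨K, hK, hflat, ⟨e⟩, hI⟩ := hG
  obtain ⟨e₀⟩ := nonempty_cycles_linearEquiv_range hK
  let eM : M ≅ K.cycles 0 := (e ≪≫ₗ e₀.symm).toModuleIso
  have hT (i j : ℤ) (hij : i + 1 = j) :
      ((cyclesSequence K i j).map (tensorFunctor C)).ShortExact :=
    hC.shortExact_map_cyclesSequence_of_auslanderClass hK hflat (auslanderClass_of_iso eM hA) hij
  obtain ⟨e₁⟩ := nonempty_map_cycles_linearEquiv_range (tensorFunctor C) hT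
  refine ⟨((tensorFunctor C).mapHomologicalComplex (ComplexShape.up ℤ)).obj K,
    acyclic_map_of_shortExact_map_cyclesSequence _ hT,
    fun n => ⟨K.X n, hflat n, ⟨.refl R _⟩⟩,
    ⟨((tensorFunctor C).mapIso eM).toLinearEquiv ≪≫ₗ e₁⟩, ?_, ?_⟩
  · exact forall_cProjective_exactAfter_iff.2 <|
      (exactAfter_iff_of_natTrans (tensorHomAdjunction C).unit
        fun n => hC.isIso_unit_of_flat (hflat n)).1 hK
  · exact hC.forall_cInjective_exactAfter_iff.2 hI

end TensorGorenstein

section CFlat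

variable {R : Type u} [CommRing R] {C W : ModuleCat.{u} R}

theorem cFlat.exists_iso (hW : cFlat C W) :
    ∃ F : ModuleCat.{u} R, Module.Flat R F ∧ Nonempty ((tensorFunctor C).obj F ≅ W) :=
  have ⟨F, hF, ⟨e⟩⟩ := hW
  ⟨F, hF, ⟨e.symm.toModuleIso⟩⟩

namespace IsSemidualizing

variable (hC : IsSemidualizing C)

include hC

theorem isIso_counit_of_cFlat (hW : cFlat C W) :
    IsIso ((tensorHomAdjunction C).counit.app W) := by
  obtain ⟨F, hF, ⟨e⟩⟩ := hW.exists_iso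
  exact (NatTrans.isIso_app_iff_of_iso _ e).1 <|
    isIso_counit_app_obj_of_isIso_unit _ (hC.isIso_unit_of_flat hF)

theorem extVanish_of_cFlat (hW : cFlat C W) : ExtVanish C W := by
  obtain ⟨F, hF, ⟨e⟩⟩ := hW.exists_iso
  exact (hC.extVanish_of_flat hF).of_iso e

theorem flat_homFunctor_of_cFlat (hW : cFlat C W) : Module.Flat R ((homFunctor C).obj W) := by
  obtain ⟨F, hF, ⟨e⟩⟩ := hW.exists_iso
  have := hC.isIso_unit_of_flat hF
  let i : F ≅ (homFunctor C).obj W :=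
    asIso ((tensorHomAdjunction C).unit.app F) ≪≫ (homFunctor C).mapIso e
  exact Module.Flat.of_linearEquiv i.symm.toLinearEquiv

end IsSemidualizing

end CFlat

section HomGorenstein

variable {R : Type u} [CommRing R] {C : ModuleCat.{u} R} {W : CochainComplex (ModuleCat.{u} R) ℤ}

theorem shortExact_map_homFunctor_cyclesSequence (hW : W.Acyclic)
    (hHW : ExactAfter (homFunctor C) W) {i j : ℤ} (hij : i + 1 = j) :
    ((cyclesSequence W i j).map (homFunctor C)).ShortExact :=
  have := preservesFiniteLimits_homFunctor C
  shortExact_map_cyclesSequence_of_acyclic_map _ hW hHW hij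

namespace IsSemidualizing

variable (hC : IsSemidualizing C) (hW : W.Acyclic) (hflat : ∀ n, cFlat C (W.X n))

include hC hW hflat

theorem epi_counit_cycles (n : ℤ) : Epi ((tensorHomAdjunction C).counit.app (W.cycles n)) :=
  epi_app_of_natTrans _ (hC.isIso_counit_of_cFlat (hflat (n - 1))).epi_of_iso
    (cyclesSequence_shortExact hW (sub_add_cancel n 1)).epi_g

variable (hHW : ExactAfter (homFunctor C) W)

include hHW

theorem isIso_counit_cycles (n : ℤ) :
    IsIso ((tensorHomAdjunction C).counit.app (W.cycles n)) := by
  have hij := sub_add_cancel n 1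
  have : Epi ((homFunctor C).map (W.toCycles (n - 1) n)) :=
    (shortExact_map_homFunctor_cyclesSequence hW hHW hij).epi_g
  have := Functor.preservesEpimorphisms_of_adjunction (tensorHomAdjunction C)
  exact isIso_τ₃_of_epi_of_isIso
    ((cyclesSequence W (n - 1) n).mapNatTrans (tensorHomAdjunction C).counit)
    ((tensorFunctor C).map_epi ((homFunctor C).map (W.toCycles (n - 1) n)))
    (cyclesSequence_shortExact hW hij) (hC.epi_counit_cycles hW hflat _)
    (hC.isIso_counit_of_cFlat (hflat _))

theorem torVanish_homFunctor_cycles (n : ℤ) :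
    TorVanish C ((homFunctor C).obj (W.cycles n)) := by
  refine torVanish_of_dimension_shift
    (P := fun M => ∃ n, (homFunctor C).obj (W.cycles n) = M) ?_ ⟨n, rfl⟩
  rintro _ ⟨n, rfl⟩
  have hij := sub_add_cancel n 1
  have hε := hC.isIso_counit_cycles hW hflat hHW (n - 1)
  have hεW := hC.isIso_counit_of_cFlat (hflat (n - 1))
  refine ⟨_, _, _, _, _, shortExact_map_homFunctor_cyclesSequence hW hHW hij, ⟨_, rfl⟩,
    torVanish_of_flat (hC.flat_homFunctor_of_cFlat (hflat _)), ?_⟩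
  exact (mono_map_iff_of_natTrans (tensorHomAdjunction C).counit hε hεW).2
    (cyclesSequence_shortExact hW hij).mono_f

theorem extVanish_cycles (n : ℤ) : ExtVanish C (W.cycles n) := by
  refine extVanish_right_of_dimension_shift (P := fun M => ∃ n, W.cycles n = M) ?_ ⟨n, rfl⟩
  rintro _ ⟨n, rfl⟩
  have hH := shortExact_map_homFunctor_cyclesSequence hW hHW (rfl : n + 1 = n + 1)
  exact ⟨_, _, _, _, _, cyclesSequence_shortExact hW rfl, ⟨n + 1, rfl⟩,
    hC.extVanish_of_cFlat (hflat n), (ModuleCat.epi_iff_surjective _).1 hH.epi_g⟩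

theorem auslanderClass_homFunctor_cycles (n : ℤ) :
    auslanderClass C ((homFunctor C).obj (W.cycles n)) := by
  have hε := hC.isIso_counit_cycles hW hflat hHW n
  exact auslanderClass_iff.2 ⟨hC.torVanish_homFunctor_cycles hW hflat hHW n,
    (hC.extVanish_cycles hW hflat hHW n).of_iso
      (asIso ((tensorHomAdjunction C).counit.app (W.cycles n))).symm,
    isIso_unit_app_obj_of_isIso_counit _ hε⟩

end IsSemidualizing

end HomGorenstein

section

variable {R : Type u} [CommRing R] {C N : ModuleCat.{u} R}

theorem wfGorenstein.exists_iso_cycles (hN : wfGorenstein C N) :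
    ∃ W : CochainComplex (ModuleCat.{u} R) ℤ, W.Acyclic ∧ (∀ n, cFlat C (W.X n)) ∧
      Nonempty (W.cycles 0 ≅ N) ∧ ExactAfter (homFunctor C) W ∧
      ∀ J, cInjective C J → ExactAfter (tensorFunctor J) W := by
  obtain ⟨W, hW, hflat, ⟨e⟩, hH, hJ⟩ := hN
  obtain ⟨e₀⟩ := nonempty_cycles_linearEquiv_range hW
  exact ⟨W, hW, hflat, ⟨(e₀ ≪≫ₗ e.symm).toModuleIso⟩, forall_cProjective_exactAfter_iff.1 hH, hJ⟩

namespace IsSemidualizing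

variable (hC : IsSemidualizing C)

include hC

theorem isIso_counit_of_wfGorenstein (hN : wfGorenstein C N) :
    IsIso ((tensorHomAdjunction C).counit.app N) := by
  obtain ⟨W, hW, hflat, ⟨e⟩, hH, -⟩ := hN.exists_iso_cycles
  exact (NatTrans.isIso_app_iff_of_iso _ e).1 (hC.isIso_counit_cycles hW hflat hH 0)

theorem auslanderClass_homFunctor (hN : wfGorenstein C N) :
    auslanderClass C ((homFunctor C).obj N) := by
  obtain ⟨W, hW, hflat, ⟨e⟩, hH, -⟩ := hN.exists_iso_cycles
  exact auslanderClass_of_iso ((homFunctor C).mapIso e)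
    (hC.auslanderClass_homFunctor_cycles hW hflat hH 0)

theorem gorensteinFlat_homFunctor (hN : wfGorenstein C N) :
    gorensteinFlat R ((homFunctor C).obj N) := by
  obtain ⟨W, hW, hflat, ⟨e⟩, hH, hJ⟩ := hN.exists_iso_cycles
  obtain ⟨e₁⟩ := nonempty_map_cycles_linearEquiv_range (homFunctor C)
    fun _ _ hij => shortExact_map_homFunctor_cyclesSequence hW hH hij
  refine ⟨((homFunctor C).mapHomologicalComplex (ComplexShape.up ℤ)).obj W, hH,
    fun n => hC.flat_homFunctor_of_cFlat (hflat n),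
    ⟨((homFunctor C).mapIso e.symm).toLinearEquiv ≪≫ₗ e₁⟩, ?_⟩
  refine hC.forall_cInjective_exactAfter_iff.1 fun J hJ' => ?_
  have hε (n : ℤ) := hC.isIso_counit_of_cFlat (hflat n)
  exact (exactAfter_iff_of_natTrans (Functor.whiskerRight (tensorHomAdjunction C).counit
    (tensorFunctor J)) fun n => inferInstanceAs (IsIso ((tensorFunctor J).map _))).2 (hJ J hJ')

end IsSemidualizing

end

end Foxby

theorem theorem3p5 {R : Type u} [CommRing R] (C : ModuleCat.{u} R)
    (hC : Foxby.IsSemidualizing C) :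
    ∃ (hF : ∀ M : (Foxby.gorensteinFlat R ⊓ Foxby.auslanderClass C).FullSubcategory,
          Foxby.wfGorenstein C ((Foxby.tensorFunctor C).obj M.obj))
      (hG : ∀ N : (Foxby.wfGorenstein C).FullSubcategory,
          (Foxby.gorensteinFlat R ⊓ Foxby.auslanderClass C)
            ((Foxby.homFunctor C).obj N.obj))
      (e : (Foxby.gorensteinFlat R ⊓ Foxby.auslanderClass C).FullSubcategory ≌
          (Foxby.wfGorenstein C).FullSubcategory),
      e.functor = (Foxby.wfGorenstein C).lift
          ((Foxby.gorensteinFlat R ⊓ Foxby.auslanderClass C).ι ⋙ Foxby.tensorFunctor C) hF ∧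
      e.inverse = (Foxby.gorensteinFlat R ⊓ Foxby.auslanderClass C).lift
          ((Foxby.wfGorenstein C).ι ⋙ Foxby.homFunctor C) hG :=
  ⟨fun M => hC.wfGorenstein_tensorFunctor M.property.1 M.property.2,
    fun N => ⟨hC.gorensteinFlat_homFunctor N.property, hC.auslanderClass_homFunctor N.property⟩,
    Foxby.exists_equivalence_fullSubcategory (Foxby.tensorHomAdjunction C) _ _
      (fun _ hM => (Foxby.auslanderClass_iff.1 hM.2).2.2)
      fun _ hN => hC.isIso_counit_of_wfGorenstein hN⟩
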